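/- Language. Fix disjoint sets $C$ (justification constants) and $D$ (propositional constants), propositional variables $V_P=\{x_0,x_1,\dots\}$ and justification variables $V_J=\{v_0,v_1,\dots\}$; $V=V_P\cup V_J$. Justification terms $Tm(C)$ are built from $V_J\cup C$ by $s\cdot t$ and $s+t$. Formulas $Fm(C,D)$ are built from $V_P\cup D$ by $\varphi\to\psi$, $\neg\varphi$, $\varphi\equiv\psi$, $\varphi<\psi$, $s\equiv t$, $s\le t$, $\varphi{:}true$, $\varphi{:}false$, $\square\varphi$, $\varphi{:}t$, $\forall x.\varphi$ (only for $x\in V_P$ free in $\varphi$) and $\bigwedge u.\varphi$ (only for $u\in V_J$ free in $\varphi$). $\exists$, $\bigvee$, $\wedge$, $\leftrightarrow$ are the usual abbreviations. Substitutions $\sigma$ map variables and constants to formulas or terms according to sort; $\varphi[\sigma]$ is capture-avoiding substitution, where a bound variable is renamed to the least variable of its sort greater than all variables free in some $\sigma(w)$, $w$ a free variable or constant of the quantified formula. $=_\alpha$ is congruence up to renaming of bound variables. $\varphi\prec\psi$ means: $\psi'[x:=\varphi]=_\alpha\psi$ for some $x\in V_P$ and some $\psi'\ne x$ in which $x$ is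 free. Axioms. $Ax$ is the smallest set that contains a sufficient set of propositional tautologies (a set of tautologies from which all tautologies follow by Modus Ponens), is closed under $\varphi\mapsto\forall x.\varphi$ ($x$ free in $\varphi$) and $\varphi\mapsto\bigwedge u.\varphi$ ($u$ free in $\varphi$), and contains all formulas of the forms: $\varphi{:}true\leftrightarrow\varphi$; $\varphi{:}false\leftrightarrow\neg\varphi$; $(\varphi\to\psi){:}s\to(\varphi{:}t\to\psi{:}(s\cdot t))$; $\varphi{:}s\to\varphi{:}(s+t)$; $\varphi{:}t\to\varphi{:}(s+t)$; $\square\varphi\leftrightarrow\bigvee u.(\varphi{:}u)$ ($u$ not free in $\varphi$); $\square\varphi\to\varphi$; $\varphi<\psi$ whenever $\varphi\prec\psi$; $(\varphi<\psi)\to((\psi<\chi)\to(\varphi<\chi))$; $\varphi\equiv\psi$ whenever $\varphi=_\alpha\psi$; $(\varphi\equiv\psi)\to(\varphi\to\psi)$; $\bigl(\bigwedge_{z}\sigma(z)\equiv\sigma'(z)\bigr)\to(\varphi[\sigma]\equiv\varphi[\sigma'])$, with $z$ ranging over the free variables of $\varphi$, and the same with a term $t$ in place of $\varphi$, for substitutions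 $\sigma,\sigma'$ that are the identity on constants; $\varphi[u:=t]\to\bigvee u.\varphi$; $\bigwedge u.\varphi\to\varphi[u:=t]$; $\bigwedge u.(\psi\to\varphi)\to(\bigwedge u.\psi\to\bigwedge u.\varphi)$; $\bigwedge u.(\psi\to\varphi)\to(\psi\to\bigwedge u.\varphi)$ ($u$ not free in $\psi$); the four analogous schemas for $\forall x$, $\exists x$ and formulas substituted for $x$; $(s\le t)\leftrightarrow\forall x.(x{:}s\to x{:}t)$; $(s\equiv t)\leftrightarrow(s\le t)\wedge(t\le s)$. $Ax+(4)$ is $Ax$ together with all formulas $\square\varphi\to\square\square\varphi$. Models. An $\in_J$-model $\mathcal M$ consists of a set $L$ of indexes with binary operations $+^{\Lambda},\cdot^{\Lambda}$ and a partial order $\le^{\Lambda}$; a set $M$ that is the disjoint union of $TRUE$ and $FALSE$; sets $REASON_l$ ($l\in L$) with $NECESSARY=\bigcup_{l\in L}REASON_l\subseteq TRUE$, such that $l\mapsto REASON_l$ is an order isomorphism of $(L,\le^{\Lambda})$ onto $(\{REASON_l\},\subseteq)$; a transitive relation $<^{\mathcal M}$ on $M$; and a function $\Gamma$ giving $\Gamma(\varphi,\gamma)\in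 M$ and $\Gamma(s,\gamma)\in L$ for formulas $\varphi$, terms $s$ and (sort-respecting) assignments $\gamma:V\to M\cup L$, such that: (EP) $\Gamma(z,\gamma)=\gamma(z)$ for $z\in V$; (CP) $\Gamma(e,\gamma)$ depends only on the values of $\gamma$ on the free variables of $e$; (SP) $\Gamma(e[\sigma],\gamma)=\Gamma(e,\gamma\sigma)$ with $\gamma\sigma(z)=\Gamma(\sigma(z),\gamma)$, for $\sigma$ the identity on constants; (RP) $\varphi\prec\psi$ implies $\Gamma(\varphi,\gamma)<^{\mathcal M}\Gamma(\psi,\gamma)$; (HP) $\Gamma(s+t,\gamma)=\Gamma(s,\gamma)+^{\Lambda}\Gamma(t,\gamma)$ and $\Gamma(s\cdot t,\gamma)=\Gamma(s,\gamma)\cdot^{\Lambda}\Gamma(t,\gamma)$; and, for all $\gamma$, the truth conditions: $\Gamma(\varphi\to\psi,\gamma)\in TRUE$ iff $\Gamma(\varphi,\gamma)\in FALSE$ or $\Gamma(\psi,\gamma)\in TRUE$; $\Gamma(\neg\varphi,\gamma)\in TRUE$ iff $\Gamma(\varphi,\gamma)\notin TRUE$; $\Gamma(\varphi{:}true,\gamma)\in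 TRUE$ iff $\Gamma(\varphi,\gamma)\in TRUE$; $\Gamma(\varphi{:}false,\gamma)\in TRUE$ iff $\Gamma(\varphi,\gamma)\in FALSE$; $\Gamma(\varphi\equiv\psi,\gamma)\in TRUE$ iff $\Gamma(\varphi,\gamma)=\Gamma(\psi,\gamma)$; $\Gamma(\varphi<\psi,\gamma)\in TRUE$ iff $\Gamma(\varphi,\gamma)<^{\mathcal M}\Gamma(\psi,\gamma)$; $\Gamma(s\equiv t,\gamma)\in TRUE$ iff $\Gamma(s,\gamma)=\Gamma(t,\gamma)$; $\Gamma(s\le t,\gamma)\in TRUE$ iff $\Gamma(s,\gamma)\le^{\Lambda}\Gamma(t,\gamma)$; $\Gamma(\square\varphi,\gamma)\in TRUE$ iff $\Gamma(\varphi,\gamma)\in NECESSARY$; $\Gamma(\varphi{:}t,\gamma)\in TRUE$ iff $\Gamma(\varphi,\gamma)\in REASON_{\Gamma(t,\gamma)}$; $\Gamma(\varphi\to\psi,\gamma)\in REASON_{\Gamma(s,\gamma)}$ and $\Gamma(\varphi,\gamma)\in REASON_{\Gamma(t,\gamma)}$ imply $\Gamma(\psi,\gamma)\in REASON_{\Gamma(s\cdot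 t,\gamma)}$; $\Gamma(\varphi,\gamma)\in REASON_{\Gamma(s,\gamma)}\cup REASON_{\Gamma(t,\gamma)}$ implies $\Gamma(\varphi,\gamma)\in REASON_{\Gamma(s+t,\gamma)}$; $\Gamma(\bigwedge u.\varphi,\gamma)\in TRUE$ iff $\Gamma(\varphi,\gamma_u^l)\in TRUE$ for all $l\in L$; $\Gamma(\forall x.\varphi,\gamma)\in TRUE$ iff $\Gamma(\varphi,\gamma_x^m)\in TRUE$ for all $m\in M$. Put $(\mathcal M,\gamma)\vDash\varphi$ iff $\Gamma(\varphi,\gamma)\in TRUE$. $\mathcal M$ satisfies (4) if $\Gamma(\square\varphi,\gamma)\in TRUE$ implies $\Gamma(\square\square\varphi,\gamma)\in TRUE$ for all $\varphi,\gamma$, and (AxNec) if $\Gamma(\square\chi,\gamma)\in TRUE$ for all $\chi\in Ax+(4)$ and all $\gamma$. Let $\mathcal L\subseteq Fm(C,D)$ be the propositional modal formulas, built from $V_P$ by $\neg,\to,\square$. An S4 frame is a set $W$ with a reflexive transitive relation $R$; for $g:W\to\{0,1\}^{V_P}$, $(w,g)\Vdash\varphi$ is the usual Kripke satisfaction relation.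 Theorem. Let $\mathcal M$ be an $\in_J$-model satisfying (AxNec) and (4), and let $\beta:V_P\to M$ be an assignment. Then there are an S4 frame $(W,R)$, a truth value assignment $g:W\to\{0,1\}^{V_P}$ and a world $w\in W$ such that for all $\varphi\in\mathcal L$ (and every extension of $\beta$ to an assignment of justification variables in $L$) $$(\mathcal M,\beta)\vDash\varphi\iff(w,g)\Vdash\varphi .$$ -/

import Mathlib

namespace EpsilonJ

/-! ### Terms, formulas, free variables, properness

Both sorts of variables are indexed by `ℕ`: propositional variable number `n` and justification
variable number `n` are different objects, because they are introduced by different constructors.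
`C` is the set of justification constants and `D` the set of propositional constants. -/

/-- Justification terms over the justification constants `C`. -/
inductive Tm (C : Type*) where
  | var (u : ℕ)
  | const (c : C)
  | app (s t : Tm C)
  | sum (s t : Tm C)

/-- Formulas, including those with vacuous quantifiers. -/
inductive PreFm (C D : Type*) where
  | var (x : ℕ)
  | const (d : D)
  | imp (φ ψ : PreFm C D)
  | neg (φ : PreFm C D)
  | eqF (φ ψ : PreFm C D)
  | ref (φ ψ : PreFm C D)
  | eqJ (s t : Tm C)
  | le (s t : Tm C)
  | tr (φ : PreFm C D)
  | fls (φ : PreFm C D)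
  | box (φ : PreFm C D)
  | mem (φ : PreFm C D) (t : Tm C)
  | allP (x : ℕ) (φ : PreFm C D)
  | allJ (u : ℕ) (φ : PreFm C D)

section Occurrences

variable {C D : Type*}

/-- The (justification) variables of a term. -/
def Tm.vars : Tm C → Finset ℕ
  | .var u => {u}
  | .const _ => ∅
  | .app s t => s.vars ∪ t.vars
  | .sum s t => s.vars ∪ t.vars

open scoped Classical in
/-- The constants of a term. -/
noncomputable def Tm.consts : Tm C → Finset C
  | .var _ => ∅
  | .const c => {c}
  | .app s t => s.consts ∪ t.consts
  | .sum s t => s.consts ∪ t.consts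

/-- Free propositional variables. -/
def PreFm.fvarP : PreFm C D → Finset ℕ
  | .var x => {x}
  | .const _ => ∅
  | .imp φ ψ => φ.fvarP ∪ ψ.fvarP
  | .neg φ => φ.fvarP
  | .eqF φ ψ => φ.fvarP ∪ ψ.fvarP
  | .ref φ ψ => φ.fvarP ∪ ψ.fvarP
  | .eqJ _ _ => ∅
  | .le _ _ => ∅
  | .tr φ => φ.fvarP
  | .fls φ => φ.fvarP
  | .box φ => φ.fvarP
  | .mem φ _ => φ.fvarP
  | .allP x φ => φ.fvarP.erase x
  | .allJ _ φ => φ.fvarP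

/-- Free justification variables. -/
def PreFm.fvarJ : PreFm C D → Finset ℕ
  | .var _ => ∅
  | .const _ => ∅
  | .imp φ ψ => φ.fvarJ ∪ ψ.fvarJ
  | .neg φ => φ.fvarJ
  | .eqF φ ψ => φ.fvarJ ∪ ψ.fvarJ
  | .ref φ ψ => φ.fvarJ ∪ ψ.fvarJ
  | .eqJ s t => s.vars ∪ t.vars
  | .le s t => s.vars ∪ t.vars
  | .tr φ => φ.fvarJ
  | .fls φ => φ.fvarJ
  | .box φ => φ.fvarJ
  | .mem φ t => φ.fvarJ ∪ t.vars
  | .allP _ φ => φ.fvarJ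
  | .allJ u φ => φ.fvarJ.erase u

open scoped Classical in
/-- Propositional constants occurring in a formula. -/
noncomputable def PreFm.conP : PreFm C D → Finset D
  | .var _ => ∅
  | .const d => {d}
  | .imp φ ψ => φ.conP ∪ ψ.conP
  | .neg φ => φ.conP
  | .eqF φ ψ => φ.conP ∪ ψ.conP
  | .ref φ ψ => φ.conP ∪ ψ.conP
  | .eqJ _ _ => ∅
  | .le _ _ => ∅
  | .tr φ => φ.conP
  | .fls φ => φ.conP
  | .box φ => φ.conP
  | .mem φ _ => φ.conP
  | .allP _ φ => φ.conP
  | .allJ _ φ => φ.conP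

open scoped Classical in
/-- Justification constants occurring in a formula. -/
noncomputable def PreFm.conJ : PreFm C D → Finset C
  | .var _ => ∅
  | .const _ => ∅
  | .imp φ ψ => φ.conJ ∪ ψ.conJ
  | .neg φ => φ.conJ
  | .eqF φ ψ => φ.conJ ∪ ψ.conJ
  | .ref φ ψ => φ.conJ ∪ ψ.conJ
  | .eqJ s t => s.consts ∪ t.consts
  | .le s t => s.consts ∪ t.consts
  | .tr φ => φ.conJ
  | .fls φ => φ.conJ
  | .box φ => φ.conJ
  | .mem φ t => φ.conJ ∪ t.consts
  | .allP _ φ => φ.conJ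
  | .allJ _ φ => φ.conJ

/-- A formula is proper if every quantifier in it binds a variable that is free in its scope. -/
def PreFm.Proper : PreFm C D → Prop
  | .var _ => True
  | .const _ => True
  | .imp φ ψ => φ.Proper ∧ ψ.Proper
  | .neg φ => φ.Proper
  | .eqF φ ψ => φ.Proper ∧ ψ.Proper
  | .ref φ ψ => φ.Proper ∧ ψ.Proper
  | .eqJ _ _ => True
  | .le _ _ => True
  | .tr φ => φ.Proper
  | .fls φ => φ.Proper
  | .box φ => φ.Proper
  | .mem φ _ => φ.Proper
  | .allP x φ => x ∈ φ.fvarP ∧ φ.Proper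
  | .allJ u φ => u ∈ φ.fvarJ ∧ φ.Proper

end Occurrences

/-- The set `Fm(C, D)` of (proper) formulas. -/
def Fm (C D : Type*) := {φ : PreFm C D // φ.Proper}

namespace Fm

variable {C D : Type*}

def fvarP (φ : Fm C D) : Finset ℕ := φ.1.fvarP
def fvarJ (φ : Fm C D) : Finset ℕ := φ.1.fvarJ

def var (x : ℕ) : Fm C D := ⟨.var x, trivial⟩
def const (d : D) : Fm C D := ⟨.const d, trivial⟩
def imp (φ ψ : Fm C D) : Fm C D := ⟨.imp φ.1 ψ.1, φ.2, ψ.2⟩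
def neg (φ : Fm C D) : Fm C D := ⟨.neg φ.1, φ.2⟩
/-- Propositional identity `φ ≡ ψ`. -/
def eqF (φ ψ : Fm C D) : Fm C D := ⟨.eqF φ.1 ψ.1, φ.2, ψ.2⟩
/-- Propositional reference `φ < ψ`. -/
def ref (φ ψ : Fm C D) : Fm C D := ⟨.ref φ.1 ψ.1, φ.2, ψ.2⟩
/-- Identity of justifications `s ≡ t`. -/
def eqJ (s t : Tm C) : Fm C D := ⟨.eqJ s t, trivial⟩
/-- Containment of justifications `s ≤ t`. -/
def le (s t : Tm C) : Fm C D := ⟨.le s t, trivial⟩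
/-- `φ : true` -/
def tr (φ : Fm C D) : Fm C D := ⟨.tr φ.1, φ.2⟩
/-- `φ : false` -/
def fls (φ : Fm C D) : Fm C D := ⟨.fls φ.1, φ.2⟩
def box (φ : Fm C D) : Fm C D := ⟨.box φ.1, φ.2⟩
/-- `φ : t` -/
def mem (φ : Fm C D) (t : Tm C) : Fm C D := ⟨.mem φ.1 t, φ.2⟩
/-- `∀ x. φ` -/
def allP (x : ℕ) (φ : Fm C D) (h : x ∈ φ.fvarP) : Fm C D := ⟨.allP x φ.1, h, φ.2⟩
/-- `⋀ u. φ` -/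
def allJ (u : ℕ) (φ : Fm C D) (h : u ∈ φ.fvarJ) : Fm C D := ⟨.allJ u φ.1, h, φ.2⟩

/-- `∃ x. φ`, that is `¬ ∀ x. ¬ φ` -/
def exP (x : ℕ) (φ : Fm C D) (h : x ∈ φ.fvarP) : Fm C D := neg (allP x (neg φ) h)
/-- `⋁ u. φ`, that is `¬ ⋀ u. ¬ φ` -/
def exJ (u : ℕ) (φ : Fm C D) (h : u ∈ φ.fvarJ) : Fm C D := neg (allJ u (neg φ) h)
def and (φ ψ : Fm C D) : Fm C D := neg (imp φ (neg ψ))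
def iff (φ ψ : Fm C D) : Fm C D := and (imp φ ψ) (imp ψ φ)

/-- `(φ₁ ∧ ⋯ ∧ φₙ) → χ`, associated to the left; this is `χ` for the empty list. -/
def conjImp : List (Fm C D) → Fm C D → Fm C D
  | [], χ => χ
  | φ :: l, χ => imp (l.foldl and φ) χ

theorem mem_fvarJ_imp_left {u : ℕ} {φ ψ : Fm C D} (h : u ∈ φ.fvarJ) : u ∈ (imp φ ψ).fvarJ :=
  Finset.mem_union_left _ h

theorem mem_fvarJ_imp_right {u : ℕ} {φ ψ : Fm C D} (h : u ∈ ψ.fvarJ) : u ∈ (imp φ ψ).fvarJ :=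
  Finset.mem_union_right _ h

theorem mem_fvarP_imp_left {x : ℕ} {φ ψ : Fm C D} (h : x ∈ φ.fvarP) : x ∈ (imp φ ψ).fvarP :=
  Finset.mem_union_left _ h

theorem mem_fvarP_imp_right {x : ℕ} {φ ψ : Fm C D} (h : x ∈ ψ.fvarP) : x ∈ (imp φ ψ).fvarP :=
  Finset.mem_union_right _ h

theorem mem_fvarJ_mem_var (u : ℕ) (φ : Fm C D) : u ∈ (mem φ (.var u)).fvarJ :=
  Finset.mem_union_right _ (Finset.mem_singleton_self u)

theorem mem_fvarP_var_mem (x : ℕ) (t : Tm C) : x ∈ (mem (var x : Fm C D) t).fvarP :=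
  Finset.mem_singleton_self x

end Fm

/-! ### Substitutions -/

/-- Substitutions with values in arbitrary formulas, proper or not. -/
structure PreSubst (C D : Type*) where
  varP : ℕ → PreFm C D
  varJ : ℕ → Tm C
  conP : D → PreFm C D
  conJ : C → Tm C

section Substitution

variable {C D : Type*}

/-- `σ[x := φ]` for a propositional variable `x`. -/
def PreSubst.updP (σ : PreSubst C D) (x : ℕ) (φ : PreFm C D) : PreSubst C D :=
  { σ with varP := Function.update σ.varP x φ }

/-- `σ[u := t]` for a justification variable `u`. -/
def PreSubst.updJ (σ : PreSubst C D) (u : ℕ) (t : Tm C) : PreSubst C D :=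
  { σ with varJ := Function.update σ.varJ u t }

/-- The least propositional variable greater than all propositional variables that are free in
some `σ(w)`, where `w` is a free variable or a constant of `φ`. -/
noncomputable def PreSubst.forcedP (σ : PreSubst C D) (φ : PreFm C D) : ℕ :=
  (φ.fvarP.biUnion (fun x => (σ.varP x).fvarP) ∪
    φ.conP.biUnion (fun d => (σ.conP d).fvarP)).sup Nat.succ

/-- The least justification variable greater than all justification variables that are free in
some `σ(w)`, where `w` is a free variable or a constant of `φ`. -/
noncomputable def PreSubst.forcedJ (σ : PreSubst C D) (φ : PreFm C D) : ℕ :=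
  (φ.fvarP.biUnion (fun x => (σ.varP x).fvarJ) ∪
    φ.conP.biUnion (fun d => (σ.conP d).fvarJ) ∪
    φ.fvarJ.biUnion (fun u => (σ.varJ u).vars) ∪
    φ.conJ.biUnion (fun c => (σ.conJ c).vars)).sup Nat.succ

/-- `t[σ]` -/
def Tm.subst (σ : PreSubst C D) : Tm C → Tm C
  | .var u => σ.varJ u
  | .const c => σ.conJ c
  | .app s t => .app (s.subst σ) (t.subst σ)
  | .sum s t => .sum (s.subst σ) (t.subst σ)

/-- `φ[σ]` -/
noncomputable def PreFm.subst : PreFm C D → PreSubst C D → PreFm C D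
  | .var x, σ => σ.varP x
  | .const d, σ => σ.conP d
  | .imp φ ψ, σ => .imp (φ.subst σ) (ψ.subst σ)
  | .neg φ, σ => .neg (φ.subst σ)
  | .eqF φ ψ, σ => .eqF (φ.subst σ) (ψ.subst σ)
  | .ref φ ψ, σ => .ref (φ.subst σ) (ψ.subst σ)
  | .eqJ s t, σ => .eqJ (s.subst σ) (t.subst σ)
  | .le s t, σ => .le (s.subst σ) (t.subst σ)
  | .tr φ, σ => .tr (φ.subst σ)
  | .fls φ, σ => .fls (φ.subst σ)
  | .box φ, σ => .box (φ.subst σ)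
  | .mem φ t, σ => .mem (φ.subst σ) (t.subst σ)
  | .allP x φ, σ =>
      .allP (σ.forcedP (.allP x φ))
        (φ.subst (σ.updP x (.var (σ.forcedP (.allP x φ)))))
  | .allJ u φ, σ =>
      .allJ (σ.forcedJ (.allJ u φ))
        (φ.subst (σ.updJ u (.var (σ.forcedJ (.allJ u φ)))))

theorem Tm.vars_subst_sub (t : Tm C) (σ : PreSubst C D) {u v : ℕ} (hu : u ∈ t.vars)
    (hv : v ∈ (σ.varJ u).vars) : v ∈ (t.subst σ).vars := by
  induction t with
  | var w => simp only [Tm.vars, Finset.mem_singleton] at hu; subst hu; exact hv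
  | const c => simp [Tm.vars] at hu
  | app s t ihs iht =>
    simp only [Tm.vars, Tm.subst, Finset.mem_union] at hu ⊢
    exact hu.imp ihs iht
  | sum s t ihs iht =>
    simp only [Tm.vars, Tm.subst, Finset.mem_union] at hu ⊢
    exact hu.imp ihs iht

theorem PreSubst.lt_forcedP {σ : PreSubst C D} {φ : PreFm C D} {x y : ℕ} (hx : x ∈ φ.fvarP)
    (hy : y ∈ (σ.varP x).fvarP) : y < σ.forcedP φ := by
  refine Nat.lt_of_succ_le (Finset.le_sup (f := Nat.succ) ?_)
  exact Finset.mem_union_left _ (Finset.mem_biUnion.2 ⟨x, hx, hy⟩)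

theorem PreSubst.lt_forcedJ {σ : PreSubst C D} {φ : PreFm C D} {u v : ℕ} (hu : u ∈ φ.fvarJ)
    (hv : v ∈ (σ.varJ u).vars) : v < σ.forcedJ φ := by
  refine Nat.lt_of_succ_le (Finset.le_sup (f := Nat.succ) ?_)
  exact Finset.mem_union_left _ (Finset.mem_union_right _ (Finset.mem_biUnion.2 ⟨u, hu, hv⟩))

theorem PreFm.fvarP_subst_sub (φ : PreFm C D) : ∀ (σ : PreSubst C D) {x y : ℕ},
    x ∈ φ.fvarP → y ∈ (σ.varP x).fvarP → y ∈ (φ.subst σ).fvarP := by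
  induction φ with
  | var z => intro σ x y hx hy; simp only [fvarP, Finset.mem_singleton] at hx; subst hx; exact hy
  | const d => intro σ x y hx; simp [fvarP] at hx
  | imp φ ψ ihφ ihψ | eqF φ ψ ihφ ihψ | ref φ ψ ihφ ihψ =>
    intro σ x y hx hy
    simp only [fvarP, subst, Finset.mem_union] at hx ⊢
    exact hx.imp (ihφ σ · hy) (ihψ σ · hy)
  | neg φ ih | tr φ ih | fls φ ih | box φ ih => exact ih
  | eqJ s t | le s t => intro σ x y hx; simp [fvarP] at hx
  | mem φ t ih => exact ih
  | allP z φ ih =>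
    intro σ x y hx hy
    have hlt := PreSubst.lt_forcedP hx hy
    simp only [fvarP, subst, Finset.mem_erase] at hx ⊢
    refine ⟨hlt.ne, ih _ hx.2 ?_⟩
    simpa [PreSubst.updP, Function.update_of_ne hx.1] using hy
  | allJ u φ ih => intro σ x y hx hy; exact ih _ hx hy

theorem PreFm.fvarJ_subst_sub (φ : PreFm C D) : ∀ (σ : PreSubst C D) {u v : ℕ},
    u ∈ φ.fvarJ → v ∈ (σ.varJ u).vars → v ∈ (φ.subst σ).fvarJ := by
  induction φ with
  | var z => intro σ u v hu; simp [fvarJ] at hu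
  | const d => intro σ u v hu; simp [fvarJ] at hu
  | imp φ ψ ihφ ihψ | eqF φ ψ ihφ ihψ | ref φ ψ ihφ ihψ =>
    intro σ u v hu hv
    simp only [fvarJ, subst, Finset.mem_union] at hu ⊢
    exact hu.imp (ihφ σ · hv) (ihψ σ · hv)
  | neg φ ih | tr φ ih | fls φ ih | box φ ih => exact ih
  | eqJ s t | le s t =>
    intro σ u v hu hv
    simp only [fvarJ, subst, Finset.mem_union] at hu ⊢
    exact hu.imp (s.vars_subst_sub σ · hv) (t.vars_subst_sub σ · hv)
  | mem φ t ih =>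
    intro σ u v hu hv
    simp only [fvarJ, subst, Finset.mem_union] at hu ⊢
    exact hu.imp (ih σ · hv) (t.vars_subst_sub σ · hv)
  | allP x φ ih => intro σ u v hu hv; exact ih _ hu hv
  | allJ w φ ih =>
    intro σ u v hu hv
    have hlt := PreSubst.lt_forcedJ hu hv
    simp only [fvarJ, subst, Finset.mem_erase] at hu ⊢
    refine ⟨hlt.ne, ih _ hu.2 ?_⟩
    simpa [PreSubst.updJ, Function.update_of_ne hu.1] using hv

/-- Substituting proper formulas into a proper formula gives a proper formula. -/
theorem PreFm.Proper.subst {φ : PreFm C D} : φ.Proper → ∀ {σ : PreSubst C D},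
    (∀ x, (σ.varP x).Proper) → (∀ d, (σ.conP d).Proper) → (φ.subst σ).Proper := by
  induction φ with
  | var z => intro _ σ hP _; exact hP z
  | const d => intro _ σ _ hD; exact hD d
  | imp φ ψ ihφ ihψ | eqF φ ψ ihφ ihψ | ref φ ψ ihφ ihψ =>
    intro h σ hP hD; exact ⟨ihφ h.1 hP hD, ihψ h.2 hP hD⟩
  | neg φ ih | tr φ ih | fls φ ih | box φ ih => intro h σ hP hD; exact ih h hP hD
  | eqJ s t | le s t => intro _ _ _ _; exact trivial
  | mem φ t ih => intro h σ hP hD; exact ih h hP hD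
  | allP x φ ih =>
    intro h σ hP hD
    refine ⟨φ.fvarP_subst_sub _ h.1 (by simp [PreSubst.updP, fvarP]), ih h.2 (fun z => ?_) hD⟩
    by_cases hz : z = x
    · subst hz; simp [PreSubst.updP, Proper]
    · simpa [PreSubst.updP, Function.update_of_ne hz] using hP z
  | allJ u φ ih =>
    intro h σ hP hD
    exact ⟨φ.fvarJ_subst_sub _ h.1 (by simp [PreSubst.updJ, Tm.vars]), ih h.2 hP hD⟩

end Substitution

/-- Substitutions: variables and constants are mapped to (proper) formulas or to terms, according
to their sort. -/
structure Subst (C D : Type*) extends PreSubst C D where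
  properP : ∀ x, (varP x).Proper
  properD : ∀ d, (conP d).Proper

section Language

variable {C D : Type*}

/-- The formula `σ(x)`. -/
def Subst.atP (σ : Subst C D) (x : ℕ) : Fm C D := ⟨σ.varP x, σ.properP x⟩

/-- `σ : V → Fm(C, D) ∪ Tm(C)`, that is, `σ` is the identity on constants. -/
def Subst.FixesConstants (σ : Subst C D) : Prop :=
  (∀ d, σ.conP d = .const d) ∧ ∀ c, σ.conJ c = .const c

/-- `φ[σ]` -/
noncomputable def Fm.subst (φ : Fm C D) (σ : Subst C D) : Fm C D :=
  ⟨φ.1.subst σ.toPreSubst, φ.2.subst σ.properP σ.properD⟩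

/-- The identity substitution. -/
def Subst.id : Subst C D where
  varP := .var
  varJ := .var
  conP := .const
  conJ := .const
  properP _ := trivial
  properD _ := trivial

/-- The substitution `[x := φ]` for a propositional variable `x`. -/
def Subst.singleP (x : ℕ) (φ : Fm C D) : Subst C D where
  toPreSubst := (Subst.id : Subst C D).toPreSubst.updP x φ.1
  properP z := by
    by_cases hz : z = x
    · subst hz; simpa [PreSubst.updP] using φ.2
    · simp [PreSubst.updP, Function.update_of_ne hz, Subst.id, PreFm.Proper]
  properD _ := trivial

/-- The substitution `[u := t]` for a justification variable `u`. -/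
def Subst.singleJ (u : ℕ) (t : Tm C) : Subst C D where
  toPreSubst := (Subst.id : Subst C D).toPreSubst.updJ u t
  properP _ := trivial
  properD _ := trivial

/-! ### Alpha-congruence and syntactical reference -/

/-- Alpha-congruence. -/
inductive Alpha : Fm C D → Fm C D → Prop
  | refl (φ : Fm C D) : Alpha φ φ
  | symm {φ ψ : Fm C D} : Alpha φ ψ → Alpha ψ φ
  | trans {φ ψ χ : Fm C D} : Alpha φ ψ → Alpha ψ χ → Alpha φ χ
  | imp {φ₁ φ₂ ψ₁ ψ₂ : Fm C D} : Alpha φ₁ ψ₁ → Alpha φ₂ ψ₂ → Alpha (φ₁.imp φ₂) (ψ₁.imp ψ₂)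
  | eqF {φ₁ φ₂ ψ₁ ψ₂ : Fm C D} : Alpha φ₁ ψ₁ → Alpha φ₂ ψ₂ → Alpha (φ₁.eqF φ₂) (ψ₁.eqF ψ₂)
  | ref {φ₁ φ₂ ψ₁ ψ₂ : Fm C D} : Alpha φ₁ ψ₁ → Alpha φ₂ ψ₂ → Alpha (φ₁.ref φ₂) (ψ₁.ref ψ₂)
  | tr {φ ψ : Fm C D} : Alpha φ ψ → Alpha φ.tr ψ.tr
  | fls {φ ψ : Fm C D} : Alpha φ ψ → Alpha φ.fls ψ.fls
  | mem {φ ψ : Fm C D} (t : Tm C) : Alpha φ ψ → Alpha (φ.mem t) (ψ.mem t)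
  | neg {φ ψ : Fm C D} : Alpha φ ψ → Alpha φ.neg ψ.neg
  | box {φ ψ : Fm C D} : Alpha φ ψ → Alpha φ.box ψ.box
  | allJ {φ ψ : Fm C D} {u v : ℕ} (hu : u ∈ φ.fvarJ) (hv : v ∈ ψ.fvarJ) :
      Alpha φ (ψ.subst (.singleJ v (.var u))) → (v ≠ u → u ∉ ψ.fvarJ) →
      Alpha (φ.allJ u hu) (ψ.allJ v hv)
  | allP {φ ψ : Fm C D} {x y : ℕ} (hx : x ∈ φ.fvarP) (hy : y ∈ ψ.fvarP) :
      Alpha φ (ψ.subst (.singleP y (.var x))) → (y ≠ x → x ∉ ψ.fvarP) →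
      Alpha (φ.allP x hx) (ψ.allP y hy)

/-- Syntactical reference `φ ≺ ψ`. -/
def SynRef (φ ψ : Fm C D) : Prop :=
  ∃ (x : ℕ) (ψ' : Fm C D), ψ' ≠ .var x ∧ x ∈ ψ'.fvarP ∧ Alpha (ψ'.subst (.singleP x φ)) ψ

/-! ### Axioms -/

/-- `χ` is (an instance of) a tautology of classical propositional logic: it is true under every
truth value assignment to formulas that respects `→` and `¬`. -/
def Tautology (χ : Fm C D) : Prop :=
  ∀ v : Fm C D → Prop, (∀ φ ψ, v (φ.imp ψ) ↔ (v φ → v ψ)) → (∀ φ, v φ.neg ↔ ¬ v φ) → v χ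

/-- Derivability from a set of formulas by Modus Ponens alone. -/
inductive MPDerivable (Φ : Set (Fm C D)) : Fm C D → Prop
  | hyp {φ : Fm C D} : φ ∈ Φ → MPDerivable Φ φ
  | mp {φ ψ : Fm C D} : MPDerivable Φ (φ.imp ψ) → MPDerivable Φ φ → MPDerivable Φ ψ

/-- `T` is a sufficient set of tautologies: it consists of tautologies, and all tautologies are
derivable from it by Modus Ponens. -/
def IsSufficient (T : Set (Fm C D)) : Prop :=
  (∀ χ ∈ T, Tautology χ) ∧ ∀ χ, Tautology χ → MPDerivable T χ

/-- The equations `σ(x) ≡ σ'(x)` for the free variables `x` of `φ`, in increasing order,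
propositional variables first. -/
def eqsOn (φ : Fm C D) (σ σ' : Subst C D) : List (Fm C D) :=
  (φ.fvarP.sort (· ≤ ·)).map (fun x => (σ.atP x).eqF (σ'.atP x)) ++
    (φ.fvarJ.sort (· ≤ ·)).map (fun u => .eqJ (σ.varJ u) (σ'.varJ u))

/-- The equations `σ(u) ≡ σ'(u)` for the variables `u` of the term `t`, in increasing order. -/
def eqsOnTm (t : Tm C) (σ σ' : Subst C D) : List (Fm C D) :=
  (t.vars.sort (· ≤ ·)).map (fun u => .eqJ (σ.varJ u) (σ'.varJ u))

/-- The set of axioms, built on the set `T` of propositional tautologies. -/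
inductive Ax (T : Set (Fm C D)) : Fm C D → Prop
  | taut {χ : Fm C D} : χ ∈ T → Ax T χ
  | genJ {φ : Fm C D} {u : ℕ} (h : u ∈ φ.fvarJ) : Ax T φ → Ax T (φ.allJ u h)
  | genP {φ : Fm C D} {x : ℕ} (h : x ∈ φ.fvarP) : Ax T φ → Ax T (φ.allP x h)
  | tarskiTrue (φ : Fm C D) : Ax T (φ.tr.iff φ)
  | tarskiFalse (φ : Fm C D) : Ax T (φ.fls.iff φ.neg)
  | application (φ ψ : Fm C D) (s t : Tm C) :
      Ax T (((φ.imp ψ).mem s).imp ((φ.mem t).imp (ψ.mem (.app s t))))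
  | weakeningLeft (φ : Fm C D) (s t : Tm C) : Ax T ((φ.mem s).imp (φ.mem (.sum s t)))
  | weakeningRight (φ : Fm C D) (s t : Tm C) : Ax T ((φ.mem t).imp (φ.mem (.sum s t)))
  | necessity (φ : Fm C D) (u : ℕ) (h : u ∉ φ.fvarJ) :
      Ax T (φ.box.iff ((φ.mem (.var u)).exJ u (Fm.mem_fvarJ_mem_var u φ)))
  | reflexivity (φ : Fm C D) : Ax T (φ.box.imp φ)
  | reference {φ ψ : Fm C D} : SynRef φ ψ → Ax T (φ.ref ψ)
  | referenceTrans (φ ψ χ : Fm C D) : Ax T ((φ.ref ψ).imp ((ψ.ref χ).imp (φ.ref χ)))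
  | alpha {φ ψ : Fm C D} : Alpha φ ψ → Ax T (φ.eqF ψ)
  | identity (φ ψ : Fm C D) : Ax T ((φ.eqF ψ).imp (φ.imp ψ))
  | substFm (φ : Fm C D) (σ σ' : Subst C D) : σ.FixesConstants → σ'.FixesConstants →
      Ax T (.conjImp (eqsOn φ σ σ') ((φ.subst σ).eqF (φ.subst σ')))
  | exIntroJ (φ : Fm C D) (u : ℕ) (h : u ∈ φ.fvarJ) (t : Tm C) :
      Ax T ((φ.subst (.singleJ u t)).imp (φ.exJ u h))
  | allElimJ (φ : Fm C D) (u : ℕ) (h : u ∈ φ.fvarJ) (t : Tm C) :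
      Ax T ((φ.allJ u h).imp (φ.subst (.singleJ u t)))
  | allDistJ (φ ψ : Fm C D) (u : ℕ) (hψ : u ∈ ψ.fvarJ) (hφ : u ∈ φ.fvarJ) :
      Ax T (((ψ.imp φ).allJ u (Fm.mem_fvarJ_imp_left hψ)).imp ((ψ.allJ u hψ).imp (φ.allJ u hφ)))
  | allConstJ (φ ψ : Fm C D) (u : ℕ) (hψ : u ∉ ψ.fvarJ) (hφ : u ∈ φ.fvarJ) :
      Ax T (((ψ.imp φ).allJ u (Fm.mem_fvarJ_imp_right hφ)).imp (ψ.imp (φ.allJ u hφ)))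
  | exIntroP (φ : Fm C D) (x : ℕ) (h : x ∈ φ.fvarP) (ψ : Fm C D) :
      Ax T ((φ.subst (.singleP x ψ)).imp (φ.exP x h))
  | allElimP (φ : Fm C D) (x : ℕ) (h : x ∈ φ.fvarP) (ψ : Fm C D) :
      Ax T ((φ.allP x h).imp (φ.subst (.singleP x ψ)))
  | allDistP (φ ψ : Fm C D) (x : ℕ) (hψ : x ∈ ψ.fvarP) (hφ : x ∈ φ.fvarP) :
      Ax T (((ψ.imp φ).allP x (Fm.mem_fvarP_imp_left hψ)).imp ((ψ.allP x hψ).imp (φ.allP x hφ)))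
  | allConstP (φ ψ : Fm C D) (x : ℕ) (hψ : x ∉ ψ.fvarP) (hφ : x ∈ φ.fvarP) :
      Ax T (((ψ.imp φ).allP x (Fm.mem_fvarP_imp_right hφ)).imp (ψ.imp (φ.allP x hφ)))
  | leDef (s t : Tm C) (x : ℕ) :
      Ax T ((Fm.le s t).iff ((((Fm.var x).mem s).imp ((Fm.var x).mem t)).allP x
        (Fm.mem_fvarP_imp_left (Fm.mem_fvarP_var_mem x s))))
  | extensionality (s t : Tm C) : Ax T ((Fm.eqJ s t).iff ((Fm.le s t).and (Fm.le t s)))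
  | substTm (t : Tm C) (σ σ' : Subst C D) : σ.FixesConstants → σ'.FixesConstants →
      Ax T (.conjImp (eqsOnTm t σ σ') (.eqJ (t.subst σ.toPreSubst) (t.subst σ'.toPreSubst)))

/-- The axioms together with all formulas `□φ → □□φ`. -/
def AxFour (T : Set (Fm C D)) (χ : Fm C D) : Prop :=
  Ax T χ ∨ ∃ φ : Fm C D, χ = φ.box.imp φ.box.box

end Language

/-! ### Models -/

/-- Assignments, given by their restrictions to the two sorts of variables. -/
structure Assignment (M L : Type*) where
  onP : ℕ → M
  onJ : ℕ → L

namespace Assignment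

variable {M L : Type*}

def updP (γ : Assignment M L) (x : ℕ) (m : M) : Assignment M L :=
  { γ with onP := Function.update γ.onP x m }

def updJ (γ : Assignment M L) (u : ℕ) (l : L) : Assignment M L :=
  { γ with onJ := Function.update γ.onJ u l }

end Assignment

/-- Models for the language `Fm(C, D)` with propositional universe `M` and set `L` of indexes.
The Gamma-function is split into its values `val` on formulas and its values `valT` on terms. -/
structure Model (C D M L : Type*) where
  plus : L → L → L
  times : L → L → L
  order : PartialOrder L
  TRUE : Set M
  FALSE : Set M
  NECESSARY : Set M
  REASON : L → Set M
  /-- the reference relation -/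
  below : M → M → Prop
  val : Fm C D → Assignment M L → M
  valT : Tm C → Assignment M L → L
  true_union_false : TRUE ∪ FALSE = Set.univ
  true_inter_false : TRUE ∩ FALSE = ∅
  necessary_subset : NECESSARY ⊆ TRUE
  necessary_eq : NECESSARY = ⋃ l, REASON l
  /-- `l ↦ REASON l` is an order isomorphism onto its range (it is injective by antisymmetry) -/
  le_iff : ∀ k l, order.le k l ↔ REASON k ⊆ REASON l
  below_trans : ∀ a b c, below a b → below b c → below a c
  ep_prop : ∀ x γ, val (.var x) γ = γ.onP x
  ep_just : ∀ u γ, valT (.var u) γ = γ.onJ u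
  cp_fm : ∀ φ γ γ', (∀ x ∈ φ.fvarP, γ.onP x = γ'.onP x) → (∀ u ∈ φ.fvarJ, γ.onJ u = γ'.onJ u) →
    val φ γ = val φ γ'
  cp_tm : ∀ s γ γ', (∀ u ∈ s.vars, γ.onJ u = γ'.onJ u) → valT s γ = valT s γ'
  sp_fm : ∀ (φ : Fm C D) (σ : Subst C D) γ, σ.FixesConstants →
    val (φ.subst σ) γ = val φ ⟨fun x => val (σ.atP x) γ, fun u => valT (σ.varJ u) γ⟩
  sp_tm : ∀ (s : Tm C) (σ : Subst C D) γ, σ.FixesConstants →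
    valT (s.subst σ.toPreSubst) γ =
      valT s ⟨fun x => val (σ.atP x) γ, fun u => valT (σ.varJ u) γ⟩
  rp : ∀ φ ψ γ, SynRef φ ψ → below (val φ γ) (val ψ γ)
  hp_sum : ∀ s t γ, valT (.sum s t) γ = plus (valT s γ) (valT t γ)
  hp_app : ∀ s t γ, valT (.app s t) γ = times (valT s γ) (valT t γ)
  tc_imp : ∀ φ ψ γ, val (φ.imp ψ) γ ∈ TRUE ↔ (val φ γ ∈ FALSE ∨ val ψ γ ∈ TRUE)
  tc_neg : ∀ φ γ, val φ.neg γ ∈ TRUE ↔ val φ γ ∉ TRUE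
  tc_tr : ∀ φ γ, val φ.tr γ ∈ TRUE ↔ val φ γ ∈ TRUE
  tc_fls : ∀ φ γ, val φ.fls γ ∈ TRUE ↔ val φ γ ∈ FALSE
  tc_eqF : ∀ φ ψ γ, val (φ.eqF ψ) γ ∈ TRUE ↔ val φ γ = val ψ γ
  tc_ref : ∀ φ ψ γ, val (φ.ref ψ) γ ∈ TRUE ↔ below (val φ γ) (val ψ γ)
  tc_eqJ : ∀ s t γ, val (.eqJ s t) γ ∈ TRUE ↔ valT s γ = valT t γ
  tc_le : ∀ s t γ, val (.le s t) γ ∈ TRUE ↔ order.le (valT s γ) (valT t γ)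
  tc_box : ∀ φ γ, val φ.box γ ∈ TRUE ↔ val φ γ ∈ NECESSARY
  tc_mem : ∀ φ t γ, val (φ.mem t) γ ∈ TRUE ↔ val φ γ ∈ REASON (valT t γ)
  tc_app : ∀ φ ψ s t γ, val (φ.imp ψ) γ ∈ REASON (valT s γ) → val φ γ ∈ REASON (valT t γ) →
    val ψ γ ∈ REASON (valT (.app s t) γ)
  tc_sum : ∀ φ s t γ, val φ γ ∈ REASON (valT s γ) ∪ REASON (valT t γ) →
    val φ γ ∈ REASON (valT (.sum s t) γ)
  tc_allJ : ∀ φ u h γ, val (φ.allJ u h) γ ∈ TRUE ↔ ∀ l, val φ (γ.updJ u l) ∈ TRUE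
  tc_allP : ∀ φ x h γ, val (φ.allP x h) γ ∈ TRUE ↔ ∀ m, val φ (γ.updP x m) ∈ TRUE

namespace Model

variable {C D M L : Type*}

/-- `(𝓜, γ) ⊨ φ` -/
def Sat (𝓜 : Model C D M L) (γ : Assignment M L) (φ : Fm C D) : Prop :=
  𝓜.val φ γ ∈ 𝓜.TRUE

/-- Truth condition (4). -/
def Four (𝓜 : Model C D M L) : Prop :=
  ∀ (φ : Fm C D) (γ : Assignment M L), 𝓜.val φ.box γ ∈ 𝓜.TRUE → 𝓜.val φ.box.box γ ∈ 𝓜.TRUE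

/-- Truth condition (AxNec), for the axioms built on the set `T` of tautologies. -/
def AxNec (𝓜 : Model C D M L) (T : Set (Fm C D)) : Prop :=
  ∀ χ : Fm C D, AxFour T χ → ∀ γ : Assignment M L, 𝓜.val χ.box γ ∈ 𝓜.TRUE

end Model

/-! ### Propositional modal logic -/

/-- The language of propositional modal logic over the propositional variables. -/
inductive ModalFm where
  | var (x : ℕ)
  | neg (φ : ModalFm)
  | imp (φ ψ : ModalFm)
  | box (φ : ModalFm)

/-- The inclusion of the modal language into `Fm(C, D)`. -/
def ModalFm.toFm {C D : Type*} : ModalFm → Fm C D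
  | .var x => .var x
  | .neg φ => φ.toFm.neg
  | .imp φ ψ => φ.toFm.imp ψ.toFm
  | .box φ => φ.toFm.box

/-- Frames of modal logic S4 with set of worlds `W`. -/
structure S4Frame (W : Type*) where
  R : W → W → Prop
  refl : ∀ w, R w w
  trans : ∀ w₁ w₂ w₃, R w₁ w₂ → R w₂ w₃ → R w₁ w₃

/-- `(w, g) ⊩ φ` -/
def S4Frame.Forces {W : Type*} (F : S4Frame W) (g : W → ℕ → Bool) : W → ModalFm → Prop
  | w, .var x => g w x = true
  | w, .neg φ => ¬ F.Forces g w φ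
  | w, .imp φ ψ => ¬ F.Forces g w φ ∨ F.Forces g w ψ
  | w, .box φ => ∀ w', F.R w w' → F.Forces g w' φ

end EpsilonJ

namespace EpsilonJ

/-! ### Derivability of distribution for `□` from the axioms -/

section Derivations

variable {C D : Type*} {T : Set (Fm C D)}

/-! Fix an assignment `γ` extending `β`, and let `Λ` be the set of modal formulas `φ` whose
necessitation `□φ` is true under `γ`. The set `Λ` is a normal extension of S4, and the modal
formulas true under `γ` form a valuation that contains `Λ`, since necessary propositions are true.
So the theory of the model is itself a world of the canonical frame of `Λ`, and the truth lemma
`ModalFm.canonicalFrame_forces` says that exactly its members are forced there. `Λ` need not be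
closed under substitution, and the canonical construction never uses such closure.

That `Λ` is normal is the part specific to justification logic. Necessitation is condition (4), and
the reflexivity and (4) schemas are necessary by (AxNec). Distribution is not an axiom:
`MPDerivable.boxDist` derives it by unfolding `□` as "some justification exists" and applying one
justification to another. Necessity passes from axioms to everything derivable because necessary
propositions are closed under Modus Ponens (`Model.sat_box_mp`). -/

theorem MPDerivable.ax_of_tautology (hT : IsSufficient T) {χ : Fm C D} (h : Tautology χ) :
    MPDerivable {χ | Ax T χ} χ := by
  have hχ := hT.2 χ h
  clear h
  induction hχ with
  | hyp h => exact .hyp (.taut h)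
  | mp _ _ ih₁ ih₂ => exact .mp ih₁ ih₂

/-- Generalization over a justification variable is admissible for derivations from axioms. -/
theorem MPDerivable.genJ {χ : Fm C D} (h : MPDerivable {χ | Ax T χ} χ) {u : ℕ} :
    ∀ hu : u ∈ χ.fvarJ, MPDerivable {χ | Ax T χ} (χ.allJ u hu) := by
  induction h with
  | hyp h => exact fun hu => .hyp (.genJ hu h)
  | @mp φ ψ hφψ hφ ih₁ ih₂ =>
    intro hu
    have hφψ' := ih₁ (Fm.mem_fvarJ_imp_right hu)
    -- Vacuous quantifiers are not formulas, so `φ` can be generalized only if `u` is free in it;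
    -- otherwise `allConstJ` replaces `allDistJ`.
    by_cases hφu : u ∈ φ.fvarJ
    · exact .mp (.mp (.hyp (.allDistJ ψ φ u hφu hu)) hφψ') (ih₂ hφu)
    · exact .mp (.mp (.hyp (.allConstJ ψ φ u hφu hu)) hφψ') hφ

/-- Since `⋁` abbreviates `¬⋀¬`, this is the contrapositive of generalizing `¬ψ → ¬φ` and moving the
quantifier past `¬ψ`. -/
theorem MPDerivable.exElimJ (hT : IsSufficient T) {φ ψ : Fm C D} {u : ℕ} (hφ : u ∈ φ.fvarJ)
    (hψ : u ∉ ψ.fvarJ) (h : MPDerivable {χ | Ax T χ} (φ.imp ψ)) :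
    MPDerivable {χ | Ax T χ} ((φ.exJ u hφ).imp ψ) := by
  have contra : MPDerivable {χ | Ax T χ} (ψ.neg.imp φ.neg) :=
    .mp (ax_of_tautology hT fun v hi hn => by simp only [hi, hn]; tauto) h
  have hφ' : u ∈ φ.neg.fvarJ := hφ
  have hall : MPDerivable {χ | Ax T χ} (ψ.neg.imp (φ.neg.allJ u hφ')) :=
    .mp (.hyp (.allConstJ φ.neg ψ.neg u hψ hφ')) (contra.genJ (Fm.mem_fvarJ_imp_right hφ'))
  exact .mp (ax_of_tautology hT fun v hi hn => by simp only [Fm.exJ, hi, hn]; tauto) hall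

theorem ModalFm.fvarJ_toFm (φ : ModalFm) : (φ.toFm : Fm C D).fvarJ = ∅ := by
  induction φ with
  | var x => rfl
  | neg φ ih | box φ ih => exact ih
  | imp φ ψ ih₁ ih₂ =>
    change (φ.toFm : Fm C D).fvarJ ∪ (ψ.toFm : Fm C D).fvarJ = ∅
    rw [ih₁, ih₂, Finset.empty_union]

/-- Modal formulas contain no quantifiers, constants or terms, so only `σ.varP` matters and no bound
variable is renamed. -/
theorem ModalFm.subst_toFm (φ : ModalFm) (σ : PreSubst C D) (hσ : σ.varP = .var) :
    (φ.toFm : Fm C D).1.subst σ = (φ.toFm : Fm C D).1 := by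
  induction φ with
  | var x => exact congrFun hσ x
  | neg φ ih => exact congrArg PreFm.neg ih
  | box φ ih => exact congrArg PreFm.box ih
  | imp φ ψ ih₁ ih₂ => exact congrArg₂ PreFm.imp ih₁ ih₂

theorem ModalFm.subst_mem_var (ψ : ModalFm) (u : ℕ) (t : Tm C) :
    ((ψ.toFm : Fm C D).mem (.var u)).subst (.singleJ u t) = (ψ.toFm : Fm C D).mem t := by
  apply Subtype.ext
  change PreFm.mem (ψ.toFm.1.subst _) (Function.update (Tm.var : ℕ → Tm C) u t u) = PreFm.mem ψ.toFm.1 t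
  rw [ModalFm.subst_toFm _ _ rfl, Function.update_self]

/-- Modal distribution is derivable from the axioms. -/
theorem MPDerivable.boxDist (hT : IsSufficient T) (φ ψ : ModalFm) :
    MPDerivable {χ | Ax T χ} ((φ.imp ψ).box.imp (φ.box.imp ψ.box)).toFm := by
  let A : Fm C D := φ.toFm
  let B : Fm C D := ψ.toFm
  have hA (u : ℕ) : u ∉ A.fvarJ := by simp [A, ModalFm.fvarJ_toFm]
  have hB (u : ℕ) : u ∉ B.fvarJ := by simp [B, ModalFm.fvarJ_toFm]
  have hAB (u : ℕ) : u ∉ (A.imp B).fvarJ := fun h =>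
    (Finset.mem_union.1 h).elim (hA u) (hB u)
  have hex : MPDerivable {χ | Ax T χ} ((B.mem (.app (.var 0) (.var 1))).imp
      ((B.mem (.var 0)).exJ 0 (Fm.mem_fvarJ_mem_var 0 B))) := by
    have h := Ax.exIntroJ (T := T) (B.mem (.var 0)) 0 (Fm.mem_fvarJ_mem_var 0 B)
      (.app (.var 0) (.var 1))
    rw [ModalFm.subst_mem_var] at h
    exact .hyp h
  -- The premises of the application axiom are swapped so that variable 1, which occurs only in the
  -- first premise, can be eliminated before variable 0.
  have happ : MPDerivable {χ | Ax T χ} ((A.mem (.var 1)).imp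
      (((A.imp B).mem (.var 0)).imp B.box)) := by
    refine .mp (.mp (.mp (ax_of_tautology hT fun v hi hn => ?_)
      (.hyp (.application A B (.var 0) (.var 1)))) hex) (.hyp (.necessity B 0 (hB 0)))
    simp only [Fm.iff, Fm.and, hi, hn]
    tauto
  have h₁ := exElimJ hT (Fm.mem_fvarJ_mem_var 1 A) (ψ := ((A.imp B).mem (.var 0)).imp B.box)
    (fun h => by
      rcases Finset.mem_union.1 h with h | h
      · rcases Finset.mem_union.1 h with h | h
        · exact hAB 1 h
        · simp [Tm.vars] at h
      · exact hB 1 h) happ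
  have h₂ : MPDerivable {χ | Ax T χ} (((A.imp B).mem (.var 0)).imp (A.box.imp B.box)) := by
    refine .mp (.mp (ax_of_tautology hT fun v hi hn => ?_) h₁) (.hyp (.necessity A 1 (hA 1)))
    simp only [Fm.iff, Fm.and, hi, hn]
    tauto
  have h₃ := exElimJ hT (Fm.mem_fvarJ_mem_var 0 (A.imp B)) (ψ := A.box.imp B.box) (hAB 0) h₂
  refine .mp (.mp (ax_of_tautology hT fun v hi hn => ?_) h₃)
    (.hyp (.necessity (A.imp B) 0 (hAB 0)))
  simp only [ModalFm.toFm, Fm.iff, Fm.and, hi, hn, A, B]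
  tauto

end Derivations

/-! ### Necessary propositions in a model -/

namespace Model

variable {C D M L : Type*} {T : Set (Fm C D)} {𝓜 : Model C D M L}

theorem sat_imp {φ ψ : Fm C D} {γ : Assignment M L} :
    𝓜.Sat γ (φ.imp ψ) ↔ (𝓜.Sat γ φ → 𝓜.Sat γ ψ) := by
  have hF : 𝓜.val φ γ ∈ 𝓜.FALSE ↔ 𝓜.val φ γ ∉ 𝓜.TRUE := by
    constructor
    · intro hf ht
      have : 𝓜.val φ γ ∈ 𝓜.TRUE ∩ 𝓜.FALSE := ⟨ht, hf⟩
      simp [𝓜.true_inter_false] at this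
    · intro ht
      have : 𝓜.val φ γ ∈ 𝓜.TRUE ∪ 𝓜.FALSE := 𝓜.true_union_false ▸ Set.mem_univ _
      exact this.resolve_left ht
  rw [Sat, tc_imp, hF, ← imp_iff_not_or]
  rfl

theorem sat_of_sat_box {φ : Fm C D} {γ : Assignment M L} (h : 𝓜.Sat γ φ.box) : 𝓜.Sat γ φ :=
  𝓜.necessary_subset ((𝓜.tc_box φ γ).1 h)

/-- The application condition speaks of values of terms, whereas the reasons at hand are arbitrary
indexes. Two fresh justification variables name these indexes, and by the coincidence property the
formulas keep their values. -/
theorem sat_box_mp {φ ψ : Fm C D} {γ : Assignment M L} (h₁ : 𝓜.Sat γ (φ.imp ψ).box)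
    (h₂ : 𝓜.Sat γ φ.box) : 𝓜.Sat γ ψ.box := by
  obtain ⟨u, hu⟩ := Infinite.exists_notMem_finset (φ.imp ψ).fvarJ
  obtain ⟨v, hv⟩ := Infinite.exists_notMem_finset (insert u (φ.imp ψ).fvarJ)
  rw [Finset.mem_insert, not_or] at hv
  rw [Sat, tc_box, necessary_eq, Set.mem_iUnion] at h₁ h₂ ⊢
  obtain ⟨k, hk⟩ := h₁
  obtain ⟨l, hl⟩ := h₂
  let γ' := (γ.updJ u k).updJ v l
  have hval (χ : Fm C D) (hχ : χ.fvarJ ⊆ (φ.imp ψ).fvarJ) : 𝓜.val χ γ' = 𝓜.val χ γ := by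
    refine 𝓜.cp_fm _ _ _ (fun _ _ => rfl) fun w hw => ?_
    have hwu : w ≠ u := fun h => hu (h ▸ hχ hw)
    have hwv : w ≠ v := fun h => hv.2 (h ▸ hχ hw)
    simp [γ', Assignment.updJ, hwu, hwv]
  have hγu : 𝓜.valT (.var u) γ' = k := by
    simp [ep_just, γ', Assignment.updJ, Ne.symm hv.1]
  have hγv : 𝓜.valT (.var v) γ' = l := by
    simp [ep_just, γ', Assignment.updJ]
  have h := 𝓜.tc_app φ ψ (.var u) (.var v) γ'
    (by rwa [hval _ subset_rfl, hγu])
    (by rwa [hval φ Finset.subset_union_left, hγv])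
  rw [hval ψ Finset.subset_union_right] at h
  exact ⟨_, h⟩

theorem AxNec.sat_box_of_derivable (h𝓜 : 𝓜.AxNec T) {χ : Fm C D}
    (h : MPDerivable {χ | Ax T χ} χ) (γ : Assignment M L) : 𝓜.Sat γ χ.box := by
  induction h with
  | hyp h => exact h𝓜 _ (.inl h) γ
  | mp _ _ ih₁ ih₂ => exact sat_box_mp ih₁ ih₂

end Model

/-! ### Canonical frames for normal extensions of S4 -/

namespace ModalFm

/-- Truth value assignments to modal formulas that respect the propositional connectives. -/
structure IsValuation (v : Set ModalFm) : Prop where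
  imp : ∀ φ ψ, φ.imp ψ ∈ v ↔ (φ ∈ v → ψ ∈ v)
  neg : ∀ φ, φ.neg ∈ v ↔ φ ∉ v

/-- Boxed formulas behave as atoms here, since a valuation is unconstrained on them. -/
def IsTautology (χ : ModalFm) : Prop := ∀ v : Set ModalFm, IsValuation v → χ ∈ v

/-- Propositional theories in the modal language. -/
structure IsTheory (S : Set ModalFm) : Prop where
  taut : ∀ χ, IsTautology χ → χ ∈ S
  mp : ∀ φ ψ, φ.imp ψ ∈ S → φ ∈ S → ψ ∈ S

/-- Normal extensions of S4, not necessarily closed under substitution. -/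
structure IsNormalS4 (Λ : Set ModalFm) : Prop extends IsTheory Λ where
  nec : ∀ φ ∈ Λ, φ.box ∈ Λ
  dist : ∀ φ ψ : ModalFm, (φ.imp ψ).box.imp (φ.box.imp ψ.box) ∈ Λ
  reflexive : ∀ φ : ModalFm, φ.box.imp φ ∈ Λ
  four : ∀ φ : ModalFm, φ.box.imp φ.box.box ∈ Λ

/-- Lindenbaum's lemma. -/
theorem IsTheory.exists_isValuation {S : Set ModalFm} (hS : IsTheory S) {φ : ModalFm}
    (hφ : φ ∉ S) : ∃ v, IsValuation v ∧ S ⊆ v ∧ φ ∉ v := by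
  obtain ⟨m, hSm, hm⟩ := zorn_subset_nonempty {S' | IsTheory S' ∧ φ ∉ S'} (by
    intro c hc hchain ⟨s, hs⟩
    refine ⟨⋃₀ c, ⟨⟨fun χ h => ⟨s, hs, (hc hs).1.taut χ h⟩, ?_⟩, ?_⟩,
      fun s hs => Set.subset_sUnion_of_mem hs⟩
    · rintro α β ⟨a, ha, hαa⟩ ⟨b, hb, hαb⟩
      rcases hchain.total ha hb with h | h
      · exact ⟨b, hb, (hc hb).1.mp _ _ (h hαa) hαb⟩
      · exact ⟨a, ha, (hc ha).1.mp _ _ hαa (h hαb)⟩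
    · rintro ⟨a, ha, hφa⟩
      exact (hc ha).2 hφa) S ⟨hS, hφ⟩
  obtain ⟨hth, hφm⟩ := hm.prop
  -- Deduction theorem: the formulas implied by `ψ` modulo `m` form a theory containing `m` and `ψ`.
  -- If it omitted `φ`, maximality would put `ψ` in `m`.
  have key (ψ : ModalFm) (hψ : ψ ∉ m) : ψ.imp φ ∈ m := by
    by_contra hcon
    refine hψ (hm.le_of_ge (y := {χ | ψ.imp χ ∈ m}) ⟨⟨fun χ h => ?_, fun α β h₁ h₂ => ?_⟩, hcon⟩
      (fun χ h => ?_) ?_)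
    · exact hth.taut _ fun v hv => (hv.imp _ _).2 fun _ => h v hv
    · refine hth.mp _ _ (hth.mp _ _ (hth.taut _ fun v hv => ?_) h₁) h₂
      simp only [hv.imp]
      tauto
    · refine hth.mp _ _ (hth.taut _ fun v hv => ?_) h
      simp only [hv.imp]
      tauto
    · refine hth.taut _ fun v hv => ?_
      simp only [hv.imp]
      tauto
  have hneg (ψ : ModalFm) : ψ.neg ∈ m ↔ ψ ∉ m := by
    constructor
    · intro h₁ h₂
      refine hφm (hth.mp _ _ (hth.mp _ _ (hth.taut _ fun v hv => ?_) h₁) h₂)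
      simp only [hv.imp, hv.neg]
      tauto
    · intro h₁
      by_contra h₂
      refine hφm (hth.mp _ _ (hth.mp _ _ (hth.taut _ fun v hv => ?_) (key _ h₁)) (key _ h₂))
      simp only [hv.imp, hv.neg]
      tauto
  refine ⟨m, ⟨fun α β => ⟨hth.mp α β, fun h => ?_⟩, hneg⟩, hSm, hφm⟩
  by_cases hα : α ∈ m
  · refine hth.mp _ _ (hth.taut _ fun v hv => ?_) (h hα)
    simp only [hv.imp]
    tauto
  · refine hth.mp _ _ (hth.taut _ fun v hv => ?_) ((hneg α).2 hα)
    simp only [hv.imp, hv.neg]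
    tauto

variable {Λ : Set ModalFm}

/-- The canonical frame: its worlds are the valuations that contain `Λ`. -/
def canonicalFrame (hΛ : IsNormalS4 Λ) : S4Frame {v : Set ModalFm // IsValuation v ∧ Λ ⊆ v} where
  R v w := ∀ φ : ModalFm, φ.box ∈ v.1 → φ ∈ w.1
  refl v φ := (v.2.1.imp _ _).1 (v.2.2 (hΛ.reflexive φ))
  trans v _ _ h₁ h₂ φ h := h₂ φ (h₁ φ.box ((v.2.1.imp _ _).1 (v.2.2 (hΛ.four φ)) h))

open scoped Classical in
theorem canonicalFrame_forces (hΛ : IsNormalS4 Λ) (φ : ModalFm) :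
    ∀ v, (canonicalFrame hΛ).Forces (fun w x => decide (ModalFm.var x ∈ w.1)) v φ ↔ φ ∈ v.1 := by
  induction φ with
  | var x => intro v; simp [S4Frame.Forces]
  | neg φ ih => intro v; rw [S4Frame.Forces, ih, v.2.1.neg]
  | imp φ ψ ih₁ ih₂ => intro v; rw [S4Frame.Forces, ih₁, ih₂, v.2.1.imp, imp_iff_not_or]
  | box φ ih =>
    intro v
    simp only [S4Frame.Forces, ih]
    refine ⟨fun h => ?_, fun h w hw => hw φ h⟩
    by_contra hφ
    -- The unboxed part of `v` omits `φ`, so it extends to a valuation omitting `φ`. That valuation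
    -- contains `Λ` by necessitation, hence is a successor world refuting `φ`.
    have hth : IsTheory {ψ : ModalFm | ψ.box ∈ v.1} :=
      ⟨fun χ hχ => v.2.2 (hΛ.nec _ (hΛ.taut _ hχ)), fun α β h₁ h₂ =>
        (v.2.1.imp _ _).1 ((v.2.1.imp _ _).1 (v.2.2 (hΛ.dist α β)) h₁) h₂⟩
    obtain ⟨w, hw, hvw, hφw⟩ := hth.exists_isValuation hφ
    exact hφw (h ⟨w, hw, fun ψ hψ => hvw (v.2.2 (hΛ.nec ψ hψ))⟩ hvw)

end ModalFm

/-- The modal formulas that are necessary under a given assignment form a normal extension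
of S4. -/
theorem Model.isNormalS4_necessary {C D M L : Type*} {T : Set (Fm C D)} {𝓜 : Model C D M L}
    (hT : IsSufficient T) (hAxNec : 𝓜.AxNec T) (hFour : 𝓜.Four) (γ : Assignment M L) :
    ModalFm.IsNormalS4 {φ | 𝓜.Sat γ φ.toFm.box} where
  -- A truth assignment on all formulas pulls back along `toFm` to a modal valuation, so modal
  -- tautologies translate to tautologies.
  taut _ hχ := hAxNec.sat_box_of_derivable (.ax_of_tautology hT fun v hi hn =>
    hχ {φ | v φ.toFm} ⟨fun _ _ => hi _ _, fun _ => hn _⟩) γ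
  mp _ _ h₁ h₂ := sat_box_mp h₁ h₂
  nec _ h := hFour _ _ h
  dist φ ψ := hAxNec.sat_box_of_derivable (.boxDist hT φ ψ) γ
  reflexive φ := hAxNec _ (.inl (.reflexivity φ.toFm)) γ
  four φ := hAxNec _ (.inr ⟨φ.toFm, rfl⟩) γ

end EpsilonJ

theorem theorem820 {C D M L : Type*} (T : Set (EpsilonJ.Fm C D)) (hT : EpsilonJ.IsSufficient T)
    (𝓜 : EpsilonJ.Model C D M L) (hAxNec : 𝓜.AxNec T) (hFour : 𝓜.Four) (β : ℕ → M) :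
    ∃ (W : Type) (F : EpsilonJ.S4Frame W) (g : W → ℕ → Bool) (w : W),
      ∀ (δ : ℕ → L) (φ : EpsilonJ.ModalFm), 𝓜.Sat ⟨β, δ⟩ φ.toFm ↔ F.Forces g w φ := by
  classical
  -- Without indexes there is no assignment of justification variables, and any frame will do.
  rcases isEmpty_or_nonempty (ℕ → L) with hL | ⟨⟨δ₀⟩⟩
  · exact ⟨Unit, ⟨fun _ _ => True, fun _ => trivial, fun _ _ _ _ _ => trivial⟩, fun _ _ => true, (),
      fun δ => hL.elim δ⟩
  have hΛ := EpsilonJ.Model.isNormalS4_necessary hT hAxNec hFour ⟨β, δ₀⟩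
  refine ⟨_, EpsilonJ.ModalFm.canonicalFrame hΛ, fun w x => decide (EpsilonJ.ModalFm.var x ∈ w.1),
    -- The chosen world is the modal theory of the model under `β` and `δ₀`.
    ⟨{φ | 𝓜.Sat ⟨β, δ₀⟩ φ.toFm}, ⟨fun _ _ => EpsilonJ.Model.sat_imp, fun _ => 𝓜.tc_neg _ _⟩,
      fun _ => EpsilonJ.Model.sat_of_sat_box⟩, fun δ φ => ?_⟩
  -- One world serves every `δ`, because modal formulas have no justification variables.
  rw [EpsilonJ.ModalFm.canonicalFrame_forces hΛ, Set.mem_ofPred_eq, EpsilonJ.Model.Sat,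
    𝓜.cp_fm φ.toFm ⟨β, δ⟩ ⟨β, δ₀⟩ (fun _ _ => rfl) fun u hu => by
      simp [EpsilonJ.ModalFm.fvarJ_toFm] at hu]
  rfl
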